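/- Let $\mathbb R^{n+1,1}$ carry the Lorentz inner product $(\cdot,\cdot)$, let $S^n=\mathbb P(\mathcal L^{n+1})$, $\mathcal L^{n+1}=\{y\in\mathbb R^{n+1,1} : (y,y)=0\}$, be the conformal $n$-sphere, and identify hyperspheres with (unit) vectors $e$, $(e,e)=1$, so that a point $p\in S^n$ lies on $e$ if $p\perp e$; $m$-spheres are the $(m+2)$-dimensional subspaces of signature $(m+1,1)$. For a smooth map $x=\langle\xi\rangle:\Sigma^m\to S^n$ with nowhere zero smooth lift $\xi$ put $x^{(1)}|_u=x(u)+d_u\xi(T_u\Sigma)$; $x$ is an immersion if $d_u\xi(v)\in x(u)$ only for $v=0$. A smooth $t:\Sigma\to\mathbb R^{n+1,1}$ represents a parallel unit normal field $t+x$ of $x$ if $(t,t)=1$, $t\perp x^{(1)}$ and $dt$ takes values in $x^{(1)}$. Two pointwise distinct smooth maps $x,x'$ satisfy the Ribaucour conditions if (i) they envelop a smooth congruence of $m$-spheres $S$, that is, $x^{(1)},x'^{(1)}\subset S$, and (ii) the bundle $x\oplus x'$, with the connection obtained from $d$ by orthogonal projection, is flat; two immersions that satisfy them form a Ribaucour pair.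 Let $x=\langle\xi\rangle:\Sigma^m\to S^n$ be an immersed submanifold with parallel unit normal fields $t_1+x,\dots,t_{n-m}+x$ that are pairwise orthogonal, and let $e_1,\dots,e_{n-m}$ be orthogonally intersecting hyperspheres, $(e_i,e_j)=\delta_{ij}$, which define the $m$-sphere $e=\langle e_1,\dots,e_{n-m}\rangle^\perp$. Given an order (permutation) $\sigma$ of $1,\dots,n-m$, the iterated dimension reduction starts with $\xi^0=\xi$, $t^0_i=t_i$ and proceeds, with $j=\sigma(l+1)$, by $$\xi^{l+1}=t^l_j+\frac{1-(e_j,t^l_j)}{(e_j,\xi^l)}\,\xi^l-e_j,\qquad t^{l+1}_i=t^l_i-\frac{(\xi^{l+1},t^l_i)}{(\xi^{l+1},\xi^l)}\,\xi^l .$$ The order $\sigma$ is called regular if in every step $\langle\xi^l\rangle$ does not meet the next hypersphere, $(\xi^l,e_{\sigma(l+1)})\neq0$ on all of $\Sigma$. Suppose that some order is regular. Then there is a map $\hat x:\Sigma^m\to S^n$ such that: 1. at every point there are coefficients $a_0,\dots,a_{n-m}\in\mathbb R$ with $$\hat\xi=a_0\xi+\sum_{i=1}^{n-m}a_i(t_i-e_i)\neq0\quad\text{and}\quad(\hat\xi,e_i)=0\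 \text{ for } i=1,\dots,n-m,$$ every such $\hat\xi$ spans $\hat x$, and the $a_i$ can be chosen as smooth functions on $\Sigma$, so that $\hat\xi$ is a smooth lift of $\hat x=\langle\hat\xi\rangle$; 2. $\hat x$ takes values in the $m$-sphere $e$; 3. $\hat x$ is the $(n-m)$-fold Ribaucour transform of $x$ obtained by the iteration in every regular order $\sigma$, and in particular does not depend on the order (Bianchi permutability): the $\xi^l$ are lifts of smooth maps $x^l:\Sigma\to S^n$ with $x^0=x$ and $x^{n-m}=\hat x$; $x^l$ takes values in $e_{\sigma(1)},\dots,e_{\sigma(l)}$; consecutive maps $x^l,x^{l+1}$ are pointwise distinct and satisfy the Ribaucour conditions, hence form a Ribaucour pair whenever both are immersions; and all $t^l_i+x^l$ are parallel unit normal fields of $x^l$ whenever $x^l$ is an immersion. One says that $\hat x$ defines Ribaucour coordinates for $x$. -/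

import Mathlib

open scoped Manifold ContDiff

noncomputable section

namespace Ribaucour

/-- The vector space underlying `ℝ^{n+1,1}`; the last coordinate is the timelike one. -/
abbrev Mink (n : ℕ) : Type := EuclideanSpace ℝ (Fin (n + 2))

/-- The Lorentz inner product `(y,z) = y₀z₀ + ⋯ + yₙzₙ - yₙ₊₁zₙ₊₁` of `ℝ^{n+1,1}`. -/
def lor {n : ℕ} (y z : Mink n) : ℝ :=
  (∑ i : Fin (n + 1), y i.castSucc * z i.castSucc) - y (Fin.last (n + 1)) * z (Fin.last (n + 1))

/-- The conformal `n`-sphere `S^n = ℙ(L^{n+1})`: the null lines of `ℝ^{n+1,1}`. -/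
def ConfSphere (n : ℕ) : Type :=
  {p : Projectivization ℝ (Mink n) // ∀ y ∈ p.submodule, lor y y = 0}

/-- The line in `ℝ^{n+1,1}` that a point of the conformal sphere is. -/
def ConfSphere.line {n : ℕ} (p : ConfSphere n) : Submodule ℝ (Mink n) := p.1.submodule

/-- The point `p` lies on the hypersphere given by `e`, that is, `p ⊥ e`. -/
def OnHypersphere {n : ℕ} (p : ConfSphere n) (e : Mink n) : Prop :=
  ∀ y ∈ p.line, lor y e = 0

/-- `S` is an `m`-sphere in the conformal `n`-sphere: an `(m+2)`-dimensional subspace of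
signature `(m+1,1)`. (In `ℝ^{n+1,1}`, a subspace has exactly one negative direction and is
non-degenerate as soon as it contains a timelike vector.) -/
def IsSphere {n : ℕ} (m : ℕ) (S : Submodule ℝ (Mink n)) : Prop :=
  Module.finrank ℝ S = m + 2 ∧ ∃ y ∈ S, lor y y < 0

section Submanifolds

variable (m : ℕ) {n : ℕ} {M : Type*} [TopologicalSpace M] [ChartedSpace (EuclideanSpace ℝ (Fin m)) M]

/-- The differential `d_u f` of a vector-valued map on the manifold. -/
def diff (f : M → Mink n) (u : M) : TangentSpace (𝓡 m) u →L[ℝ] Mink n :=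
  mfderiv (𝓡 m) 𝓘(ℝ, Mink n) f u

/-- `ξ ∈ Γ(x)` is a (smooth, nowhere zero) lift of `x`, so that `x = ⟨ξ⟩`. -/
structure IsLift (ξ : M → Mink n) (x : M → ConfSphere n) : Prop where
  smooth : ContMDiff (𝓡 m) 𝓘(ℝ, Mink n) ∞ ξ
  ne_zero : ∀ u, ξ u ≠ 0
  mem : ∀ u, ξ u ∈ (x u).line

/-- `x` is an immersion into the conformal sphere. A smooth map into the conformal sphere always
has a global smooth lift (the one with last coordinate `1`), and the condition on the
differential does not depend on the lift. -/
def IsImmersion (x : M → ConfSphere n) : Prop :=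
  ∃ ξ : M → Mink n, IsLift m ξ x ∧
    ∀ (u : M) (v : TangentSpace (𝓡 m) u), diff m ξ u v ∈ (x u).line → v = 0

/-- The fibre at `u` of the derived bundle, `x^{(1)}|_u = x(u) + d_uξ(T_uM)` for `x = ⟨ξ⟩`;
it does not depend on the lift `ξ` of `x`. -/
def derived (ξ : M → Mink n) (u : M) : Submodule ℝ (Mink n) :=
  Submodule.span ℝ {ξ u} ⊔ LinearMap.range (diff m ξ u).toLinearMap

/-- `t` represents a parallel unit normal field `t + x` of `x = ⟨ξ⟩`, a section of the weightless
normal bundle `(x^{(1)})^⊥ / x`; it is parallel when `d(t + x)` takes values in `x^{(1)} / x`. -/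
structure IsParallelUnitNormal (ξ t : M → Mink n) : Prop where
  smooth : ContMDiff (𝓡 m) 𝓘(ℝ, Mink n) ∞ t
  unit : ∀ u, lor (t u) (t u) = 1
  normal : ∀ u, ∀ y ∈ derived m ξ u, lor (t u) y = 0
  parallel : ∀ (u : M) (v : TangentSpace (𝓡 m) u), diff m t u v ∈ derived m ξ u

/-- `x` and `x'` envelop a (smooth) congruence `S` of `m`-spheres, where `m` is the dimension of
the manifold: the sphere `S u` contains the points `x u` and `x' u` and touches `x` and `x'`
there. -/
def Envelop (x x' : M → ConfSphere n) : Prop :=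
  ∃ (S : M → Submodule ℝ (Mink n)) (ξ ξ' : M → Mink n),
    (∀ u, IsSphere m (S u)) ∧
    (∀ u₀, ∃ U : Set M, IsOpen U ∧ u₀ ∈ U ∧ ∃ f : Fin (m + 2) → M → Mink n,
      (∀ i, ContMDiffOn (𝓡 m) 𝓘(ℝ, Mink n) ∞ (f i) U) ∧
      ∀ u ∈ U, S u = Submodule.span ℝ (Set.range fun i => f i u)) ∧
    IsLift m ξ x ∧ IsLift m ξ' x' ∧
    ∀ u, derived m ξ u ≤ S u ∧ derived m ξ' u ≤ S u

/-- The bundle `x ⊕ x'`, with the connection obtained from `d` by orthogonal projection, is flat: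
locally it has a frame of parallel sections. A section `f` is parallel when `df ⊥ x ⊕ x'`. -/
def FlatSum (x x' : M → ConfSphere n) : Prop :=
  ∀ u₀, ∃ U : Set M, IsOpen U ∧ u₀ ∈ U ∧ ∃ f : Fin 2 → M → Mink n,
    (∀ i, ContMDiffOn (𝓡 m) 𝓘(ℝ, Mink n) ∞ (f i) U) ∧
    ∀ u ∈ U, LinearIndependent ℝ (fun i => f i u) ∧
      ∀ i, f i u ∈ (x u).line ⊔ (x' u).line ∧
        ∀ (v : TangentSpace (𝓡 m) u), ∀ y ∈ (x u).line ⊔ (x' u).line, lor (diff m (f i) u v) y = 0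

/-- The conditions that make two immersions a Ribaucour pair: `x` and `x'` are pointwise distinct
(so that `x ⊕ x'` is a `(1,1)`-bundle), they envelop a congruence of `m`-spheres, and `x ⊕ x'` is
flat. -/
structure RibaucourConditions (x x' : M → ConfSphere n) : Prop where
  distinct : ∀ u, x u ≠ x' u
  envelop : Envelop m x x'
  flat : FlatSum m x x'

/-- Two immersed submanifolds form a Ribaucour pair. -/
structure IsRibaucourPair (x x' : M → ConfSphere n) : Prop where
  immersion_left : IsImmersion m x
  immersion_right : IsImmersion m x'
  conditions : RibaucourConditions m x x'

end Submanifolds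

section Reduction

variable {n k : ℕ} {M : Type*}

/-- Dimension reduction of `x = ⟨ξ⟩` into the hypersphere `e` by means of the normal field `t`:
`s - e`, where `s = t + ((1 - (e,t)) / (e,ξ)) ξ` touches both `x` and `e`. -/
def reduceLift (e : Mink n) (ξ t : M → Mink n) : M → Mink n := fun u =>
  (t u + ((1 - lor e (t u)) / lor e (ξ u)) • ξ u) - e

/-- The normal field of `x' = ⟨ξ'⟩` that corresponds to the normal field `t` of `x = ⟨ξ⟩`,
represented by the common normal `s = t - ((ξ',t) / (ξ',ξ)) ξ`, which is orthogonal to `ξ` and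
`ξ'`. Only its class modulo `x'` matters: `reduceLift` does not change when a multiple of the
lift is added to the normal field. -/
def transportNormal (ξ ξ' t : M → Mink n) : M → Mink n := fun u =>
  t u - (lor (ξ' u) (t u) / lor (ξ' u) (ξ u)) • ξ u

/-- One step of the iteration: from a lift and `k` normal fields, reduce into the hypersphere
`e j` by means of the `j`-th normal field, and carry all normal fields over to the result. -/
def reduceStep (e : Fin k → Mink n) (j : Fin k)
    (d : (M → Mink n) × (Fin k → M → Mink n)) : (M → Mink n) × (Fin k → M → Mink n) :=
  (reduceLift (e j) d.1 (d.2 j),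
    fun i => transportNormal d.1 (reduceLift (e j) d.1 (d.2 j)) (d.2 i))

/-- The result of the first `l` dimension reductions, into the hyperspheres
`e (σ 0), e (σ 1), …` in the order given by `σ`: a lift, and the transported normal fields. -/
def iter (e : Fin k → Mink n) (ξ : M → Mink n) (t : Fin k → M → Mink n)
    (σ : Equiv.Perm (Fin k)) (l : Fin (k + 1)) : (M → Mink n) × (Fin k → M → Mink n) :=
  Fin.induction (motive := fun _ => (M → Mink n) × (Fin k → M → Mink n))
    (ξ, t) (fun j d => reduceStep e (σ j) d) l

/-- The dimension reduction works in every step of the iteration in the order `σ`: the submanifold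
that has been reached does not meet the next hypersphere. -/
def RegularOrder (e : Fin k → Mink n) (ξ : M → Mink n) (t : Fin k → M → Mink n)
    (σ : Equiv.Perm (Fin k)) : Prop :=
  ∀ (l : Fin k) (u : M), lor ((iter e ξ t σ l.castSucc).1 u) (e (σ l)) ≠ 0

/-- The combination `a₀ ξ + ∑ aᵢ (tᵢ - eᵢ)` at the point `u`. -/
def combo (e : Fin k → Mink n) (ξ : M → Mink n) (t : Fin k → M → Mink n)
    (a₀ : ℝ) (a : Fin k → ℝ) (u : M) : Mink n :=
  a₀ • ξ u + ∑ i, a i • (t i u - e i)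

end Reduction

end Ribaucour

end

/-! The work is done with frames rather than immersions, because a transform may fail to be
immersed. An `AdaptedFrame` is a null lift ξ with orthonormal normals tᵢ such that dξ and all dtⱼ
are orthogonal to every tᵢ. Where ξ spans an immersion, a dimension count identifies the derived
bundle with {ξ, t₁, …}^⊥, so the tᵢ are parallel (`AdaptedFrame.isParallelUnitNormal`).

For one reduction ξ' = s - e, the derivative dξ' is a combination of dtⱼ, dξ and ξ, hence orthogonal
to ξ and to all tᵢ. This one fact makes the transported frame adapted again
(`AdaptedFrame.transport`). It also makes ξ' a parallel section of x ⊕ x' and gives the complement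
of the transported normals as enveloped sphere congruence (`AdaptedFrame.ribaucourConditions`).

Permutability is triangular linear algebra at each point. Every combination of ξ and the tᵢ - eᵢ
lies in the span of ξ⁰, …, ξᵏ (`combo_mem_span`). The products (ξᵖ, e_{σ(i)}) vanish for p > i
(`AdaptedFrame.iter_sphere`) and are non-zero for p = i by regularity. Hence only multiples of ξᵏ
solve the system (ξ̂, eᵢ) = 0 (`AdaptedFrame.combo_mem_span_last`). The system does not mention σ,
so all regular orders end at the same point. -/

noncomputable section

namespace Ribaucour

/-! ### Linear algebra of the Lorentz product -/

section LorentzProduct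

variable {n k : ℕ}

/-- The Lorentz inner product as a continuous bilinear map. -/
def lorL (n : ℕ) : Mink n →L[ℝ] Mink n →L[ℝ] ℝ :=
  (∑ i : Fin (n + 1), (EuclideanSpace.proj (𝕜 := ℝ) i.castSucc : Mink n →L[ℝ] ℝ).smulRight
      (EuclideanSpace.proj i.castSucc : Mink n →L[ℝ] ℝ)) -
    (EuclideanSpace.proj (𝕜 := ℝ) (Fin.last (n + 1)) : Mink n →L[ℝ] ℝ).smulRight
      (EuclideanSpace.proj (Fin.last (n + 1)) : Mink n →L[ℝ] ℝ)

theorem lor_eq_lorL (y z : Mink n) : lor y z = lorL n y z := by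
  simp [lor, lorL]

theorem lor_comm (y z : Mink n) : lor y z = lor z y := by
  simp [lor, mul_comm]

theorem lor_add_left (y y' z : Mink n) : lor (y + y') z = lor y z + lor y' z := by
  simp [lor_eq_lorL]

theorem lor_add_right (y z z' : Mink n) : lor y (z + z') = lor y z + lor y z' := by
  simp [lor_eq_lorL]

theorem lor_sub_left (y y' z : Mink n) : lor (y - y') z = lor y z - lor y' z := by
  simp [lor_eq_lorL]

theorem lor_sub_right (y z z' : Mink n) : lor y (z - z') = lor y z - lor y z' := by
  simp [lor_eq_lorL]

theorem lor_smul_left (c : ℝ) (y z : Mink n) : lor (c • y) z = c * lor y z := by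
  simp [lor_eq_lorL]

theorem lor_smul_right (c : ℝ) (y z : Mink n) : lor y (c • z) = c * lor y z := by
  simp [lor_eq_lorL]

theorem lor_zero_left (z : Mink n) : lor 0 z = 0 := by
  simp [lor_eq_lorL]

theorem lor_sum_left {ι : Type*} (s : Finset ι) (f : ι → Mink n) (z : Mink n) :
    lor (∑ i ∈ s, f i) z = ∑ i ∈ s, lor (f i) z := by
  simp [lor_eq_lorL]

theorem lor_sum_right {ι : Type*} (s : Finset ι) (f : ι → Mink n) (z : Mink n) :
    lor z (∑ i ∈ s, f i) = ∑ i ∈ s, lor z (f i) := by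
  simp [lor_eq_lorL]

/-- The unit timelike coordinate vector. -/
def timeVec (n : ℕ) : Mink n := EuclideanSpace.single (Fin.last (n + 1)) 1

theorem lor_timeVec (y : Mink n) : lor y (timeVec n) = -y (Fin.last (n + 1)) := by
  have h (i : Fin (n + 1)) : i.castSucc ≠ Fin.last (n + 1) := (Fin.castSucc_lt_last i).ne
  simp [lor, timeVec, h]

/-- A null vector without time component has a spatial part of Euclidean norm zero. This supplies
the nondegeneracy needed below and a denominator for comparing lifts. -/
theorem lor_timeVec_ne_zero {y : Mink n} (hy : y ≠ 0) (h0 : lor y y = 0) :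
    lor y (timeVec n) ≠ 0 := by
  rw [lor_timeVec]
  intro h
  have hl : y (Fin.last (n + 1)) = 0 := by linarith
  have hs : ∑ i : Fin (n + 1), y i.castSucc * y i.castSucc = 0 := by
    simpa [lor, hl] using h0
  rw [Finset.sum_eq_zero_iff_of_nonneg fun i _ => mul_self_nonneg _] at hs
  refine hy (PiLp.ext fun i => ?_)
  induction i using Fin.lastCases with
  | last => exact hl
  | cast i => exact mul_self_eq_zero.mp (hs i (Finset.mem_univ i))

/-- The common orthogonal complement of a family of vectors. -/
def lorPerp (t : Fin k → Mink n) : Submodule ℝ (Mink n) :=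
  LinearMap.ker (LinearMap.pi fun i => (lorL n (t i)).toLinearMap)

theorem mem_lorPerp {t : Fin k → Mink n} {y : Mink n} :
    y ∈ lorPerp t ↔ ∀ i, lor (t i) y = 0 := by
  simp [lorPerp, funext_iff, lor_eq_lorL]

theorem lor_sum_smul_of_orthonormal {t : Fin k → Mink n}
    (ht : ∀ i j, lor (t i) (t j) = if i = j then 1 else 0) (b : Fin k → ℝ) (i : Fin k) :
    lor (t i) (∑ j, b j • t j) = b i := by
  simp [lor_sum_right, lor_smul_right, ht]

/-- Orthonormality makes y ↦ ((tᵢ, y))ᵢ surjective, so rank-nullity applies. -/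
theorem finrank_lorPerp {m : ℕ} {t : Fin k → Mink (m + k)}
    (ht : ∀ i j, lor (t i) (t j) = if i = j then 1 else 0) :
    Module.finrank ℝ (lorPerp t) = m + 2 := by
  have hs : Function.Surjective
      (LinearMap.pi fun i => (lorL (m + k) (t i)).toLinearMap : Mink (m + k) →ₗ[ℝ] Fin k → ℝ) := by
    intro b
    refine ⟨∑ j, b j • t j, funext fun i => ?_⟩
    simpa [lor_eq_lorL] using lor_sum_smul_of_orthonormal ht b i
  have h := LinearMap.finrank_range_add_finrank_ker
    (LinearMap.pi fun i => (lorL (m + k) (t i)).toLinearMap : Mink (m + k) →ₗ[ℝ] Fin k → ℝ)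
  rw [LinearMap.range_eq_top.mpr hs, finrank_top, Module.finrank_fin_fun,
    finrank_euclideanSpace_fin] at h
  change k + Module.finrank ℝ (lorPerp t) = _ at h
  omega

/-- Orthogonal projection to the complement of an orthonormal family. -/
def perpProj (t : Fin k → Mink n) (y : Mink n) : Mink n := y - ∑ i, lor (t i) y • t i

theorem perpProj_mem {t : Fin k → Mink n}
    (ht : ∀ i j, lor (t i) (t j) = if i = j then 1 else 0) (y : Mink n) :
    perpProj t y ∈ lorPerp t := by
  rw [mem_lorPerp]
  intro i
  rw [perpProj, lor_sub_right, lor_sum_smul_of_orthonormal ht, sub_self]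

theorem perpProj_eq_self {t : Fin k → Mink n} {y : Mink n} (hy : y ∈ lorPerp t) :
    perpProj t y = y := by
  rw [mem_lorPerp] at hy
  simp [perpProj, hy]

/-- If `p` is null and orthogonal to an orthonormal family, then `p^⊥` cuts the complement of the
family in a proper subspace. -/
theorem finrank_lorPerp_inf_lt {m : ℕ} {t : Fin k → Mink (m + k)} {p : Mink (m + k)}
    (ht : ∀ i j, lor (t i) (t j) = if i = j then 1 else 0) (hp : p ≠ 0) (h0 : lor p p = 0)
    (htp : ∀ i, lor (t i) p = 0) :
    Module.finrank ℝ (lorPerp t ⊓ LinearMap.ker (lorL (m + k) p).toLinearMap :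
      Submodule ℝ (Mink (m + k))) ≤ m + 1 := by
  have hlt : (lorPerp t ⊓ LinearMap.ker (lorL (m + k) p).toLinearMap :
      Submodule ℝ (Mink (m + k))) < lorPerp t := by
    refine lt_of_le_of_ne inf_le_left fun h => ?_
    -- The projected time vector witnesses properness: since p ⊥ tᵢ, projecting does not change its
    -- product with p, which is non-zero.
    have hmem := perpProj_mem ht (timeVec (m + k))
    rw [← h] at hmem
    have h1 : lor p (perpProj t (timeVec (m + k))) = 0 := by
      simpa [lor_eq_lorL] using hmem.2
    refine lor_timeVec_ne_zero hp h0 ?_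
    simpa [perpProj, lor_sub_right, lor_sum_right, lor_smul_right, lor_comm p (t _), htp] using h1
  have := Submodule.finrank_lt_finrank_of_lt hlt
  rw [finrank_lorPerp ht] at this
  omega

end LorentzProduct

/-! ### Points of the conformal sphere as null lines -/

section ConfSphere

variable {n : ℕ}

/-- The point of the conformal sphere spanned by a null vector. -/
def ConfSphere.mk (y : Mink n) (hy : y ≠ 0) (h0 : lor y y = 0) : ConfSphere n :=
  ⟨Projectivization.mk ℝ y hy, by
    rw [Projectivization.submodule_mk]
    intro z hz
    obtain ⟨c, rfl⟩ := Submodule.mem_span_singleton.mp hz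
    rw [lor_smul_left, lor_smul_right, h0, mul_zero, mul_zero]⟩

theorem ConfSphere.line_mk (y : Mink n) (hy : y ≠ 0) (h0 : lor y y = 0) :
    (ConfSphere.mk y hy h0).line = Submodule.span ℝ {y} :=
  Projectivization.submodule_mk y hy

theorem ConfSphere.ext_line {p q : ConfSphere n} (h : p.line = q.line) : p = q :=
  Subtype.ext (Projectivization.submodule_injective h)

theorem ConfSphere.line_eq_span {p : ConfSphere n} {y : Mink n} (hy : y ≠ 0)
    (h : y ∈ p.line) : p.line = Submodule.span ℝ {y} := by
  have h1 : Module.finrank ℝ p.line = 1 := p.1.finrank_submodule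
  refine (Submodule.eq_of_le_of_finrank_eq ?_ ?_).symm
  · rwa [Submodule.span_singleton_le_iff_mem]
  · rw [h1, finrank_span_singleton hy]

theorem ConfSphere.lor_self {p : ConfSphere n} {y : Mink n} (h : y ∈ p.line) : lor y y = 0 :=
  p.2 y h

end ConfSphere

/-! ### Product rules on the manifold -/

section Calculus

variable {m n : ℕ} {M : Type*} [TopologicalSpace M] [ChartedSpace (EuclideanSpace ℝ (Fin m)) M]

/-- One product rule serves both scalar multiplication and the Lorentz product; it is the bilinear
rule read in a chart. -/
theorem _root_.HasMFDerivAt.bilin {E F G : Type*} [NormedAddCommGroup E] [NormedSpace ℝ E]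
    [NormedAddCommGroup F] [NormedSpace ℝ F] [NormedAddCommGroup G] [NormedSpace ℝ G]
    (B : E →L[ℝ] F →L[ℝ] G) {f : M → E} {g : M → F} {u : M}
    {f' : TangentSpace (𝓡 m) u →L[ℝ] E} {g' : TangentSpace (𝓡 m) u →L[ℝ] F}
    (hf : HasMFDerivAt (𝓡 m) 𝓘(ℝ, E) f u f') (hg : HasMFDerivAt (𝓡 m) 𝓘(ℝ, F) g u g') :
    HasMFDerivAt (𝓡 m) 𝓘(ℝ, G) (fun w => B (f w) (g w)) u
      ((B (f u)).comp g' + (B.flip (g u)).comp f' : TangentSpace (𝓡 m) u →L[ℝ] G) := by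
  refine ⟨B.isBoundedBilinearMap.continuous.continuousAt.comp (hf.1.prodMk hg.1), ?_⟩
  have h : HasFDerivWithinAt
      (writtenInExtChartAt (𝓡 m) 𝓘(ℝ, G) u fun w => B (f w) (g w)) _ _ _ :=
    B.hasFDerivWithinAt_of_bilinear hf.2 hg.2
  -- In the chart, f and g are evaluated at the chart inverse of the image of u, which is u.
  rw [extChartAt_to_inv] at h
  exact h

theorem mdifferentiableAt_of_smooth {E : Type*} [NormedAddCommGroup E] [NormedSpace ℝ E]
    {f : M → E} (hf : ContMDiff (𝓡 m) 𝓘(ℝ, E) ∞ f) (u : M) :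
    MDifferentiableAt (𝓡 m) 𝓘(ℝ, E) f u :=
  hf.mdifferentiable (by simp) u

theorem diff_add {f g : M → Mink n} (hf : ContMDiff (𝓡 m) 𝓘(ℝ, Mink n) ∞ f)
    (hg : ContMDiff (𝓡 m) 𝓘(ℝ, Mink n) ∞ g) (u : M) (v : TangentSpace (𝓡 m) u) :
    diff m (fun w => f w + g w) u v = diff m f u v + diff m g u v := by
  have h := ((mdifferentiableAt_of_smooth hf u).hasMFDerivAt.add
    (mdifferentiableAt_of_smooth hg u).hasMFDerivAt).mfderiv
  exact DFunLike.congr_fun h v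

theorem diff_sub {f g : M → Mink n} (hf : ContMDiff (𝓡 m) 𝓘(ℝ, Mink n) ∞ f)
    (hg : ContMDiff (𝓡 m) 𝓘(ℝ, Mink n) ∞ g) (u : M) (v : TangentSpace (𝓡 m) u) :
    diff m (fun w => f w - g w) u v = diff m f u v - diff m g u v := by
  have h := ((mdifferentiableAt_of_smooth hf u).hasMFDerivAt.sub
    (mdifferentiableAt_of_smooth hg u).hasMFDerivAt).mfderiv
  exact DFunLike.congr_fun h v

theorem diff_sub_const {f : M → Mink n} (hf : ContMDiff (𝓡 m) 𝓘(ℝ, Mink n) ∞ f) (e : Mink n)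
    (u : M) (v : TangentSpace (𝓡 m) u) :
    diff m (fun w => f w - e) u v = diff m f u v := by
  rw [diff_sub hf contMDiff_const]
  have h : diff m (fun _ : M => e) u v = 0 := by
    rw [diff, mfderiv_const]
    rfl
  rw [h, sub_zero]

/-- The number r is the derivative of c along v. Its value is never needed: f will be a null lift,
and its multiples drop out of every later condition. -/
theorem diff_smul {c : M → ℝ} {f : M → Mink n} (hc : ContMDiff (𝓡 m) 𝓘(ℝ, ℝ) ∞ c)
    (hf : ContMDiff (𝓡 m) 𝓘(ℝ, Mink n) ∞ f) (u : M) (v : TangentSpace (𝓡 m) u) :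
    ∃ r : ℝ, diff m (fun w => c w • f w) u v = c u • diff m f u v + r • f u := by
  have h := (HasMFDerivAt.bilin (ContinuousLinearMap.lsmul ℝ ℝ)
    (mdifferentiableAt_of_smooth hc u).hasMFDerivAt
    (mdifferentiableAt_of_smooth hf u).hasMFDerivAt).mfderiv
  exact ⟨_, DFunLike.congr_fun h v⟩

theorem smooth_smul {c : M → ℝ} {f : M → Mink n} (hc : ContMDiff (𝓡 m) 𝓘(ℝ, ℝ) ∞ c)
    (hf : ContMDiff (𝓡 m) 𝓘(ℝ, Mink n) ∞ f) :
    ContMDiff (𝓡 m) 𝓘(ℝ, Mink n) ∞ fun u => c u • f u :=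
  hc.smul hf

theorem smooth_lor {f g : M → Mink n} (hf : ContMDiff (𝓡 m) 𝓘(ℝ, Mink n) ∞ f)
    (hg : ContMDiff (𝓡 m) 𝓘(ℝ, Mink n) ∞ g) :
    ContMDiff (𝓡 m) 𝓘(ℝ, ℝ) ∞ fun u => lor (f u) (g u) := by
  simp only [lor_eq_lorL]
  exact ((lorL n).contMDiff.comp hf).clm_apply hg

theorem lor_diff_add_lor_diff {f g : M → Mink n} (hf : ContMDiff (𝓡 m) 𝓘(ℝ, Mink n) ∞ f)
    (hg : ContMDiff (𝓡 m) 𝓘(ℝ, Mink n) ∞ g) {c : ℝ} (hc : ∀ u, lor (f u) (g u) = c)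
    (u : M) (v : TangentSpace (𝓡 m) u) :
    lor (f u) (diff m g u v) + lor (diff m f u v) (g u) = 0 := by
  have h := (HasMFDerivAt.bilin (lorL n)
    (mdifferentiableAt_of_smooth hf u).hasMFDerivAt
    (mdifferentiableAt_of_smooth hg u).hasMFDerivAt).mfderiv
  have h0 : (fun w => lorL n (f w) (g w)) = fun _ => c := by
    funext w
    rw [← lor_eq_lorL, hc]
  rw [h0, mfderiv_const] at h
  rw [lor_eq_lorL, lor_eq_lorL]
  exact (DFunLike.congr_fun h v).symm

end Calculus

/-! ### Independence of the lift; rank of the derived bundle -/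

section Lifts

variable {m n : ℕ} {M : Type*} [TopologicalSpace M] [ChartedSpace (EuclideanSpace ℝ (Fin m)) M]

theorem IsLift.line_eq {ξ : M → Mink n} {x : M → ConfSphere n} (h : IsLift m ξ x) (u : M) :
    (x u).line = Submodule.span ℝ {ξ u} :=
  ConfSphere.line_eq_span (h.ne_zero u) (h.mem u)

theorem IsLift.null {ξ : M → Mink n} {x : M → ConfSphere n} (h : IsLift m ξ x) (u : M) :
    lor (ξ u) (ξ u) = 0 :=
  ConfSphere.lor_self (h.mem u)

theorem IsLift.lift_diff_lift {ξ : M → Mink n} {x : M → ConfSphere n}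
    (h : IsLift m ξ x) (u : M) (v : TangentSpace (𝓡 m) u) : lor (ξ u) (diff m ξ u v) = 0 := by
  have := lor_diff_add_lor_diff h.smooth h.smooth h.null u v
  rw [lor_comm (diff m ξ u v)] at this
  linarith

/-- Two lifts of the same map differ by a smooth factor. -/
theorem IsLift.exists_smooth_factor {ξ η : M → Mink n} {x : M → ConfSphere n}
    (hξ : IsLift m ξ x) (hη : IsLift m η x) :
    ∃ c : M → ℝ, ContMDiff (𝓡 m) 𝓘(ℝ, ℝ) ∞ c ∧ ∀ u, η u = c u • ξ u := by
  have h0 (u : M) := lor_timeVec_ne_zero (hξ.ne_zero u) (hξ.null u)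
  -- The factor is the ratio of the time coordinates, which is visibly smooth.
  refine ⟨fun u => lor (η u) (timeVec n) / lor (ξ u) (timeVec n),
    (smooth_lor hη.smooth contMDiff_const).div₀ (smooth_lor hξ.smooth contMDiff_const) h0,
    fun u => ?_⟩
  have hu := hη.mem u
  rw [hξ.line_eq u] at hu
  obtain ⟨c, hc⟩ := Submodule.mem_span_singleton.mp hu
  beta_reduce
  rw [← hc, lor_smul_left, mul_div_cancel_right₀ _ (h0 u)]

/-- The immersion condition can be tested on any lift. -/
theorem IsImmersion.eq_zero_of_diff_mem {ξ : M → Mink n} {x : M → ConfSphere n}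
    (hx : IsImmersion m x) (hξ : IsLift m ξ x) {u : M} {v : TangentSpace (𝓡 m) u}
    (hv : diff m ξ u v ∈ (x u).line) : v = 0 := by
  obtain ⟨η, hη, h⟩ := hx
  obtain ⟨c, hc, hcη⟩ := hξ.exists_smooth_factor hη
  refine h u v ?_
  obtain ⟨r, hr⟩ := diff_smul hc hξ.smooth u v
  rw [funext hcη, hr]
  exact add_mem (Submodule.smul_mem _ _ hv) (Submodule.smul_mem _ _ (hξ.mem u))

/-- An immersion makes dξ injective with range transverse to the line of ξ, so the two dimensions
add. -/
theorem IsImmersion.finrank_derived {ξ : M → Mink n} {x : M → ConfSphere n}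
    (hx : IsImmersion m x) (hξ : IsLift m ξ x) (u : M) :
    Module.finrank ℝ (derived m ξ u) = m + 1 := by
  have hinj : Function.Injective (diff m ξ u).toLinearMap := by
    rw [injective_iff_map_eq_zero]
    intro v hv
    refine hx.eq_zero_of_diff_mem hξ (u := u) ?_
    have hv' : diff m ξ u v = 0 := hv
    rw [hv']
    exact zero_mem _
  have hdisj : Submodule.span ℝ {ξ u} ⊓ LinearMap.range (diff m ξ u).toLinearMap = ⊥ := by
    rw [Submodule.eq_bot_iff]
    rintro _ ⟨hy, v, rfl⟩
    have : v = 0 := by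
      refine hx.eq_zero_of_diff_mem hξ (u := u) ?_
      rw [hξ.line_eq u]
      exact hy
    rw [this, map_zero]
  have h1 := Submodule.finrank_sup_add_finrank_inf_eq (Submodule.span ℝ {ξ u})
    (LinearMap.range (diff m ξ u).toLinearMap)
  have h2 : Module.finrank ℝ (LinearMap.range (diff m ξ u).toLinearMap) = m :=
    (LinearMap.finrank_range_of_inj hinj).trans finrank_euclideanSpace_fin
  rw [hdisj, finrank_bot, finrank_span_singleton (hξ.ne_zero u), h2] at h1
  rw [derived]
  omega

end Lifts

/-! ### Adapted frames -/

section Frames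

variable {m n k : ℕ} {M : Type*} [TopologicalSpace M] [ChartedSpace (EuclideanSpace ℝ (Fin m)) M]

/-- A null lift with orthonormal normal fields whose derivatives, and that of the lift, have no
normal component. In contrast to `IsParallelUnitNormal`, this passes to Ribaucour transforms that
fail to be immersions. -/
structure AdaptedFrame (m : ℕ) {n k : ℕ} {M : Type*} [TopologicalSpace M]
    [ChartedSpace (EuclideanSpace ℝ (Fin m)) M]
    (ξ : M → Mink n) (t : Fin k → M → Mink n) : Prop where
  smooth_lift : ContMDiff (𝓡 m) 𝓘(ℝ, Mink n) ∞ ξ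
  ne_zero : ∀ u, ξ u ≠ 0
  null : ∀ u, lor (ξ u) (ξ u) = 0
  smooth_normal : ∀ i, ContMDiff (𝓡 m) 𝓘(ℝ, Mink n) ∞ (t i)
  orthonormal : ∀ u i j, lor (t i u) (t j u) = if i = j then 1 else 0
  normal : ∀ u i, lor (t i u) (ξ u) = 0
  normal_diff_lift : ∀ u i v, lor (t i u) (diff m ξ u v) = 0
  normal_diff_normal : ∀ u i j v, lor (t i u) (diff m (t j) u v) = 0

theorem mem_derived_self (ξ : M → Mink n) (u : M) : ξ u ∈ derived m ξ u :=
  Submodule.mem_sup_left (Submodule.mem_span_singleton_self _)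

theorem diff_mem_derived (ξ : M → Mink n) (u : M) (v : TangentSpace (𝓡 m) u) :
    diff m ξ u v ∈ derived m ξ u :=
  Submodule.mem_sup_right ⟨v, rfl⟩

theorem derived_le {ξ : M → Mink n} {u : M} {S : Submodule ℝ (Mink n)} (h : ξ u ∈ S)
    (hd : ∀ v, diff m ξ u v ∈ S) : derived m ξ u ≤ S := by
  refine sup_le ((Submodule.span_singleton_le_iff_mem _ _).mpr h) ?_
  rintro _ ⟨v, rfl⟩
  exact hd v

theorem AdaptedFrame.of_parallel {ξ : M → Mink n} {x : M → ConfSphere n}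
    {t : Fin k → M → Mink n} (hξ : IsLift m ξ x) (ht : ∀ i, IsParallelUnitNormal m ξ (t i))
    (htt : ∀ i j, i ≠ j → ∀ u, lor (t i u) (t j u) = 0) : AdaptedFrame m ξ t where
  smooth_lift := hξ.smooth
  ne_zero := hξ.ne_zero
  null := hξ.null
  smooth_normal i := (ht i).smooth
  orthonormal u i j := by
    split_ifs with h
    · rw [← h, (ht i).unit]
    · exact htt i j h u
  normal u i := (ht i).normal u _ (mem_derived_self ξ u)
  normal_diff_lift u i v := (ht i).normal u _ (diff_mem_derived ξ u v)
  normal_diff_normal u i j v := (ht i).normal u _ ((ht j).parallel u v)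

namespace AdaptedFrame

variable {ξ : M → Mink n} {t : Fin k → M → Mink n}

theorem lift_diff_normal (h : AdaptedFrame m ξ t) (u : M) (i : Fin k)
    (v : TangentSpace (𝓡 m) u) : lor (ξ u) (diff m (t i) u v) = 0 := by
  have := lor_diff_add_lor_diff (h.smooth_normal i) h.smooth_lift (fun u => h.normal u i) u v
  rw [h.normal_diff_lift, zero_add, lor_comm] at this
  exact this

/-- The map into the conformal sphere that the lift of an adapted frame spans. -/
def point (h : AdaptedFrame m ξ t) (u : M) : ConfSphere n :=
  ConfSphere.mk (ξ u) (h.ne_zero u) (h.null u)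

theorem line_point (h : AdaptedFrame m ξ t) (u : M) :
    (h.point u).line = Submodule.span ℝ {ξ u} :=
  ConfSphere.line_mk _ _ _

theorem isLift (h : AdaptedFrame m ξ t) : IsLift m ξ h.point where
  smooth := h.smooth_lift
  ne_zero := h.ne_zero
  mem u := by
    rw [h.line_point]
    exact Submodule.mem_span_singleton_self _

theorem lift_diff_lift (h : AdaptedFrame m ξ t) (u : M) (v : TangentSpace (𝓡 m) u) :
    lor (ξ u) (diff m ξ u v) = 0 :=
  h.isLift.lift_diff_lift u v

/-- The normal fields of an adapted frame are parallel where the lift spans an immersion. -/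
theorem isParallelUnitNormal {ξ : M → Mink (m + k)} {t : Fin k → M → Mink (m + k)}
    (h : AdaptedFrame m ξ t) (himm : IsImmersion m h.point) (i : Fin k) :
    IsParallelUnitNormal m ξ (t i) where
  smooth := h.smooth_normal i
  unit u := by simp [h.orthonormal u i i]
  normal u y hy := by
    have hle : derived m ξ u ≤ lorPerp fun i => t i u :=
      derived_le (mem_lorPerp.mpr (h.normal u))
        fun v => mem_lorPerp.mpr fun i => h.normal_diff_lift u i v
    exact mem_lorPerp.mp (hle hy) i
  parallel u v := by
    have hmem {y : Mink (m + k)} (h1 : ∀ i, lor (t i u) y = 0) (h2 : lor (ξ u) y = 0) :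
        y ∈ (lorPerp (fun i => t i u) ⊓ LinearMap.ker (lorL (m + k) (ξ u)).toLinearMap :
          Submodule ℝ (Mink (m + k))) :=
      ⟨mem_lorPerp.mpr h1, by simpa [lor_eq_lorL] using h2⟩
    have hle := derived_le (hmem (h.normal u) (h.null u)) fun v =>
      hmem (fun i => h.normal_diff_lift u i v) (h.lift_diff_lift u v)
    -- The derived space has dimension m + 1, and the space {ξ, t₁, …}^⊥ containing it has at most
    -- that. They agree, so membership of dtᵢ reduces to orthogonality relations.
    have heq := Submodule.eq_of_le_of_finrank_le hle <| by
      rw [himm.finrank_derived h.isLift u]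
      exact finrank_lorPerp_inf_lt (h.orthonormal u) (h.ne_zero u) (h.null u) (h.normal u)
    rw [heq]
    exact hmem (fun j => h.normal_diff_normal u j i v) (h.lift_diff_normal u i v)

end AdaptedFrame

end Frames

/-! ### Smoothness of the sphere congruence -/

section Congruence

variable {m k : ℕ} {M : Type*} [TopologicalSpace M] [ChartedSpace (EuclideanSpace ℝ (Fin m)) M]

/-- The orthogonal complement of a smooth orthonormal family has smooth local frames. -/
theorem exists_local_frame_lorPerp {t : Fin k → M → Mink (m + k)}
    (hs : ∀ i, ContMDiff (𝓡 m) 𝓘(ℝ, Mink (m + k)) ∞ (t i))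
    (ht : ∀ u i j, lor (t i u) (t j u) = if i = j then 1 else 0) (u₀ : M) :
    ∃ U : Set M, IsOpen U ∧ u₀ ∈ U ∧ ∃ f : Fin (m + 2) → M → Mink (m + k),
      (∀ i, ContMDiffOn (𝓡 m) 𝓘(ℝ, Mink (m + k)) ∞ (f i) U) ∧
      ∀ u ∈ U, lorPerp (fun i => t i u) = Submodule.span ℝ (Set.range fun i => f i u) := by
  let b := Module.finBasisOfFinrankEq ℝ (lorPerp fun i => t i u₀) (finrank_lorPerp (ht u₀))
  -- A basis of the complement at u₀ is projected to the complements at other points; linear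
  -- independence is an open condition.
  let f : Fin (m + 2) → M → Mink (m + k) := fun l u => perpProj (fun i => t i u) (b l)
  have hf (l : Fin (m + 2)) : ContMDiff (𝓡 m) 𝓘(ℝ, Mink (m + k)) ∞ (f l) :=
    contMDiff_const.sub <| contMDiff_finsetSum fun i _ =>
      (smooth_lor (hs i) contMDiff_const).smul (hs i)
  have hcont : Continuous fun u l => f l u := continuous_pi fun l => (hf l).continuous
  refine ⟨{u | LinearIndependent ℝ fun l => f l u},
    isOpen_setOfPred_linearIndependent.preimage hcont, ?_, f, fun l => (hf l).contMDiffOn, ?_⟩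
  · have h0 : (fun l => f l u₀) = fun l => ((b l : lorPerp fun i => t i u₀) : Mink (m + k)) :=
      funext fun l => perpProj_eq_self (b l).2
    change LinearIndependent ℝ fun l => f l u₀
    rw [h0]
    exact b.linearIndependent.map' (Submodule.subtype _) (Submodule.ker_subtype _)
  · intro u hu
    refine (Submodule.eq_of_le_of_finrank_eq ?_ ?_).symm
    · rw [Submodule.span_le]
      rintro _ ⟨l, rfl⟩
      exact perpProj_mem (ht u) _
    · rw [finrank_lorPerp (ht u), finrank_span_eq_card hu, Fintype.card_fin]

end Congruence

/-! ### A single dimension reduction -/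

section Step

/-- The coefficient of ξ in s is chosen to make (s, e) = 1 = (e, e). -/
theorem lor_reduceLift_sphere {n : ℕ} {M : Type*} {e : Mink n} (he : lor e e = 1)
    {ξ t : M → Mink n} {u : M} (hne : lor e (ξ u) ≠ 0) :
    lor (reduceLift e ξ t u) e = 0 := by
  rw [reduceLift, lor_sub_left, lor_add_left, lor_smul_left, he, lor_comm (t u),
    lor_comm (ξ u), div_mul_cancel₀ _ hne]
  ring

variable {m n k : ℕ} {M : Type*} [TopologicalSpace M] [ChartedSpace (EuclideanSpace ℝ (Fin m)) M]
  {ξ : M → Mink n} {t : Fin k → M → Mink n} {e : Mink n}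

namespace AdaptedFrame

/-- With regularity, this product gives ξ' ≠ 0, x ≠ x', and the non-zero denominator in
`transportNormal`. -/
theorem lor_reduceLift_lift (h : AdaptedFrame m ξ t) (e : Mink n) (j : Fin k) (u : M) :
    lor (reduceLift e ξ (t j) u) (ξ u) = -lor e (ξ u) := by
  simp [reduceLift, lor_sub_left, lor_add_left, lor_smul_left, h.normal, h.null]

theorem lor_normal_reduceLift (h : AdaptedFrame m ξ t) (e : Mink n) (i j : Fin k) (u : M) :
    lor (t i u) (reduceLift e ξ (t j) u) = (if i = j then 1 else 0) - lor e (t i u) := by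
  simp [reduceLift, lor_sub_right, lor_add_right, lor_smul_right, h.normal, h.orthonormal,
    lor_comm e]

theorem reduceLift_null (h : AdaptedFrame m ξ t) (he : lor e e = 1) {u : M}
    (hne : lor e (ξ u) ≠ 0) (j : Fin k) :
    lor (reduceLift e ξ (t j) u) (reduceLift e ξ (t j) u) = 0 := by
  have h1 := lor_reduceLift_sphere (t := t j) he hne
  have h2 := h.lor_normal_reduceLift e j j u
  have h3 := h.lor_reduceLift_lift e j u
  rw [lor_comm] at h1 h3
  -- Only one factor is expanded; the products of ξ' with tⱼ, ξ and e are already known.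
  have h4 (y : Mink n) : lor (reduceLift e ξ (t j) u) y =
      lor (t j u) y + (1 - lor e (t j u)) / lor e (ξ u) * lor (ξ u) y - lor e y := by
    rw [reduceLift, lor_sub_left, lor_add_left, lor_smul_left]
  rw [h4, h1, h2, h3, if_pos rfl]
  field_simp
  ring

theorem reduceLift_ne_zero (h : AdaptedFrame m ξ t) {u : M} (hne : lor e (ξ u) ≠ 0) (j : Fin k) :
    reduceLift e ξ (t j) u ≠ 0 := by
  intro h0
  have := h.lor_reduceLift_lift e j u
  rw [h0, lor_zero_left] at this
  exact hne (by linarith)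

theorem smooth_reduceLift (h : AdaptedFrame m ξ t) (hne : ∀ u, lor e (ξ u) ≠ 0) (j : Fin k) :
    ContMDiff (𝓡 m) 𝓘(ℝ, Mink n) ∞ (reduceLift e ξ (t j)) :=
  ((h.smooth_normal j).add <|
    ((contMDiff_const.sub (smooth_lor contMDiff_const (h.smooth_normal j))).div₀
      (smooth_lor contMDiff_const h.smooth_lift) hne).smul h.smooth_lift).sub contMDiff_const

/-- Since e is constant and differentiating the coefficient contributes only a multiple of ξ,
nothing but dtⱼ, dξ and ξ appears. All three are orthogonal to ξ and to every tᵢ, whatever a and b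
are. -/
theorem diff_reduceLift (h : AdaptedFrame m ξ t) (hne : ∀ u, lor e (ξ u) ≠ 0) (j : Fin k)
    (u : M) (v : TangentSpace (𝓡 m) u) :
    ∃ a b : ℝ, diff m (reduceLift e ξ (t j)) u v =
      diff m (t j) u v + (a • diff m ξ u v + b • ξ u) := by
  have hc : ContMDiff (𝓡 m) 𝓘(ℝ, ℝ) ∞ fun u => (1 - lor e (t j u)) / lor e (ξ u) :=
    (contMDiff_const.sub (smooth_lor contMDiff_const (h.smooth_normal j))).div₀
      (smooth_lor contMDiff_const h.smooth_lift) hne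
  obtain ⟨b, hb⟩ := diff_smul hc h.smooth_lift u v
  have hcξ := smooth_smul hc h.smooth_lift
  refine ⟨(1 - lor e (t j u)) / lor e (ξ u), b, ?_⟩
  rw [← hb, ← diff_add (h.smooth_normal j) hcξ]
  exact diff_sub_const ((h.smooth_normal j).add hcξ) e u v

theorem normal_diff_reduceLift (h : AdaptedFrame m ξ t) (hne : ∀ u, lor e (ξ u) ≠ 0)
    (i j : Fin k) (u : M) (v : TangentSpace (𝓡 m) u) :
    lor (t i u) (diff m (reduceLift e ξ (t j)) u v) = 0 := by
  obtain ⟨a, b, hab⟩ := h.diff_reduceLift hne j u v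
  simp [hab, lor_add_right, lor_smul_right, h.normal, h.normal_diff_lift, h.normal_diff_normal]

theorem lift_diff_reduceLift (h : AdaptedFrame m ξ t) (hne : ∀ u, lor e (ξ u) ≠ 0)
    (j : Fin k) (u : M) (v : TangentSpace (𝓡 m) u) :
    lor (ξ u) (diff m (reduceLift e ξ (t j)) u v) = 0 := by
  obtain ⟨a, b, hab⟩ := h.diff_reduceLift hne j u v
  simp [hab, lor_add_right, lor_smul_right, h.null, h.lift_diff_lift, h.lift_diff_normal]

/-- An adapted frame yields, by dimension reduction, an adapted frame of the transform. -/
theorem transport (h : AdaptedFrame m ξ t) (he : lor e e = 1) (hne : ∀ u, lor e (ξ u) ≠ 0)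
    (j : Fin k) : AdaptedFrame m (reduceLift e ξ (t j))
      (fun i => transportNormal ξ (reduceLift e ξ (t j)) (t i)) := by
  have hne' (u : M) : lor (reduceLift e ξ (t j) u) (ξ u) ≠ 0 := by
    rw [h.lor_reduceLift_lift]
    exact neg_ne_zero.mpr (hne u)
  have hs := h.smooth_reduceLift hne j
  have hc (i : Fin k) : ContMDiff (𝓡 m) 𝓘(ℝ, ℝ) ∞ fun u =>
      lor (reduceLift e ξ (t j) u) (t i u) / lor (reduceLift e ξ (t j) u) (ξ u) :=
    (smooth_lor hs (h.smooth_normal i)).div₀ (smooth_lor hs h.smooth_lift) hne'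
  refine ⟨hs, fun u => h.reduceLift_ne_zero (hne u) j, fun u => h.reduceLift_null he (hne u) j,
    fun i => (h.smooth_normal i).sub ((hc i).smul h.smooth_lift), fun u i l => ?_, fun u i => ?_,
    fun u i v => ?_, fun u i l v => ?_⟩
  · simp [transportNormal, lor_sub_left, lor_sub_right, lor_smul_left, lor_smul_right, h.normal,
      h.null, h.orthonormal, lor_comm (ξ u) (t _ u)]
  · rw [transportNormal, lor_sub_left, lor_smul_left, lor_comm (ξ u), lor_comm (t i u),
      div_mul_cancel₀ _ (hne' u), sub_self]
  · rw [transportNormal, lor_sub_left, lor_smul_left, h.normal_diff_reduceLift hne,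
      h.lift_diff_reduceLift hne, mul_zero, sub_zero]
  · obtain ⟨b, hb⟩ := diff_smul (hc l) h.smooth_lift u v
    have hd := diff_sub (h.smooth_normal l) (smooth_smul (hc l) h.smooth_lift) u v
    change lor _ (diff m (fun w => t l w - _ • ξ w) u v) = 0
    rw [hd, hb]
    simp [transportNormal, lor_sub_left, lor_sub_right, lor_smul_left, lor_smul_right,
      lor_add_right, h.normal, h.null, h.normal_diff_lift, h.normal_diff_normal,
      h.lift_diff_lift, h.lift_diff_normal]

/-- The correction that makes tᵢ orthogonal to ξ' also cancels (tᵢ, e), leaving δᵢⱼ. This is what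
keeps later lifts inside e. -/
theorem lor_transportNormal_sphere (h : AdaptedFrame m ξ t) {u : M} (hne : lor e (ξ u) ≠ 0)
    (i j : Fin k) : lor (transportNormal ξ (reduceLift e ξ (t j)) (t i) u) e =
      if i = j then 1 else 0 := by
  rw [transportNormal, lor_sub_left, lor_smul_left, h.lor_reduceLift_lift,
    lor_comm (reduceLift e ξ (t j) u), h.lor_normal_reduceLift, lor_comm (ξ u), lor_comm (t i u)]
  field_simp
  ring

end AdaptedFrame

end Step

/-! ### The Ribaucour conditions for one step -/

section RibaucourStep

variable {m k : ℕ} {M : Type*} [TopologicalSpace M] [ChartedSpace (EuclideanSpace ℝ (Fin m)) M]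
  {ξ : M → Mink (m + k)} {t : Fin k → M → Mink (m + k)} {e : Mink (m + k)}

/-- A subspace that contains two non-orthogonal null vectors contains a timelike vector. -/
theorem exists_timelike {n : ℕ} {S : Submodule ℝ (Mink n)} {y z : Mink n} (hy : y ∈ S)
    (hz : z ∈ S) (hy0 : lor y y = 0) (hz0 : lor z z = 0) (h : lor y z ≠ 0) :
    ∃ w ∈ S, lor w w < 0 := by
  -- This vector has square -2 (y, z)².
  refine ⟨y - lor y z • z, sub_mem hy (S.smul_mem _ hz), ?_⟩
  have : 0 < lor y z * lor y z := mul_self_pos.mpr h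
  rw [lor_sub_left, lor_sub_right, lor_sub_right, lor_smul_left, lor_smul_left, lor_smul_right,
    lor_smul_right, hy0, hz0, lor_comm z y]
  linarith

/-- If the lift `η` is parallel with respect to `x ⊕ y`, then `x ⊕ y` is flat. -/
theorem flatSum_of_lifts {n : ℕ} {x y : M → ConfSphere n} {ξ η : M → Mink n}
    (hξ : IsLift m ξ x) (hη : IsLift m η y) (hne : ∀ u, lor (ξ u) (η u) ≠ 0)
    (hd : ∀ u v, lor (ξ u) (diff m η u v) = 0) : FlatSum m x y := by
  intro u₀
  have hc : ContMDiff (𝓡 m) 𝓘(ℝ, ℝ) ∞ fun u => (lor (ξ u) (η u))⁻¹ :=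
    (smooth_lor hξ.smooth hη.smooth).inv₀ hne
  -- Rescaling ξ so that (ζ, η) = 1 makes it parallel too: differentiating gives (dζ, η) = -(ζ, dη)
  -- = 0, and (dζ, ξ) = 0 by nullity. Thus ζ, η is a global parallel frame.
  obtain ⟨ζ, hζ⟩ : ∃ ζ : M → Mink n, ζ = fun u => (lor (ξ u) (η u))⁻¹ • ξ u := ⟨_, rfl⟩
  have hsζ : ContMDiff (𝓡 m) 𝓘(ℝ, Mink n) ∞ ζ := hζ ▸ smooth_smul hc hξ.smooth
  have hζη (u : M) : lor (ζ u) (η u) = 1 := by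
    rw [hζ, lor_smul_left, inv_mul_cancel₀ (hne u)]
  have hmem (u : M) : ζ u ∈ (x u).line := by
    rw [hζ]
    exact Submodule.smul_mem _ _ (hξ.mem u)
  have hperp {u : M} {z : Mink n} (h1 : lor z (ξ u) = 0) (h2 : lor z (η u) = 0) :
      ∀ w ∈ (x u).line ⊔ (y u).line, lor z w = 0 := by
    intro w hw
    rw [hξ.line_eq, hη.line_eq] at hw
    obtain ⟨p, hp, q, hq, rfl⟩ := Submodule.mem_sup.mp hw
    obtain ⟨a, rfl⟩ := Submodule.mem_span_singleton.mp hp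
    obtain ⟨b, rfl⟩ := Submodule.mem_span_singleton.mp hq
    rw [lor_add_right, lor_smul_right, lor_smul_right, h1, h2, mul_zero, mul_zero, add_zero]
  have hpζ (u : M) (v : TangentSpace (𝓡 m) u) :
      ∀ w ∈ (x u).line ⊔ (y u).line, lor (diff m ζ u v) w = 0 := by
    refine hperp ?_ ?_
    · obtain ⟨r, hr⟩ := diff_smul hc hξ.smooth u v
      rw [hζ, hr, lor_add_left, lor_smul_left, lor_smul_left, hξ.null, lor_comm (diff m ξ u v),
        hξ.lift_diff_lift, mul_zero, mul_zero, add_zero]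
    · have h := lor_diff_add_lor_diff hsζ hη.smooth hζη u v
      have h0 : lor (ζ u) (diff m η u v) = 0 := by rw [hζ, lor_smul_left, hd, mul_zero]
      rwa [h0, zero_add] at h
  have hpη (u : M) (v : TangentSpace (𝓡 m) u) :
      ∀ w ∈ (x u).line ⊔ (y u).line, lor (diff m η u v) w = 0 :=
    hperp (by rw [lor_comm, hd]) (by rw [lor_comm, hη.lift_diff_lift])
  refine ⟨Set.univ, isOpen_univ, Set.mem_univ _, ![ζ, η], Fin.forall_fin_two.mpr
    ⟨hsζ.contMDiffOn, hη.smooth.contMDiffOn⟩, fun u _ => ⟨?_, Fin.forall_fin_two.mpr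
    ⟨⟨Submodule.mem_sup_left (hmem u), hpζ u⟩, Submodule.mem_sup_right (hη.mem u), hpη u⟩⟩⟩
  rw [show (fun i => ![ζ, η] i u) = ![ζ u, η u] from funext (Fin.forall_fin_two.mpr ⟨rfl, rfl⟩),
    LinearIndependent.pair_iff]
  intro a b hab
  have h1 := congrArg (fun w => lor w (η u)) hab
  simp only [lor_add_left, lor_smul_left, hζη, hη.null, lor_zero_left] at h1
  have ha : a = 0 := by linarith
  rw [ha, zero_smul, zero_add] at hab
  exact ⟨ha, (smul_eq_zero.mp hab).resolve_right (hη.ne_zero u)⟩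

/-- A map and its dimension reduction satisfy the Ribaucour conditions. -/
theorem AdaptedFrame.ribaucourConditions (h : AdaptedFrame m ξ t) (he : lor e e = 1)
    (hne : ∀ u, lor e (ξ u) ≠ 0) (j : Fin k) :
    RibaucourConditions m h.point (h.transport he hne j).point := by
  have h' := h.transport he hne j
  have hne' (u : M) : lor (ξ u) (reduceLift e ξ (t j) u) ≠ 0 := by
    rw [lor_comm, h.lor_reduceLift_lift]
    exact neg_ne_zero.mpr (hne u)
  refine ⟨fun u hu => ?_, ?_, ?_⟩
  · have hmem := h.isLift.mem u
    rw [hu, h'.line_point] at hmem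
    obtain ⟨c, hc⟩ := Submodule.mem_span_singleton.mp hmem
    refine hne' u ?_
    rw [← hc, lor_smul_left, h'.null, mul_zero]
  · have hlift (u : M) : ξ u ∈ lorPerp fun i =>
        transportNormal ξ (reduceLift e ξ (t j)) (t i) u := mem_lorPerp.mpr fun i => by
      simp [transportNormal, lor_sub_left, lor_smul_left, h.normal, h.null]
    -- The transported normals are combinations of the tᵢ and ξ, so their complement touches x as
    -- well as x'.
    refine ⟨fun u => lorPerp fun i => transportNormal ξ (reduceLift e ξ (t j)) (t i) u, ξ,
      reduceLift e ξ (t j), fun u => ⟨finrank_lorPerp (h'.orthonormal u), ?_⟩,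
      exists_local_frame_lorPerp h'.smooth_normal h'.orthonormal, h.isLift, h'.isLift,
      fun u => ⟨?_, ?_⟩⟩
    · exact exists_timelike (hlift u) (mem_lorPerp.mpr (h'.normal u)) (h.null u) (h'.null u)
        (hne' u)
    · refine derived_le (hlift u) fun v => mem_lorPerp.mpr fun i => ?_
      simp [transportNormal, lor_sub_left, lor_smul_left, h.normal_diff_lift, h.lift_diff_lift]
    · exact derived_le (mem_lorPerp.mpr (h'.normal u)) fun v => mem_lorPerp.mpr fun i =>
        h'.normal_diff_lift u i v
  · exact flatSum_of_lifts h.isLift h'.isLift hne' (fun u v => h.lift_diff_reduceLift hne j u v)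

end RibaucourStep

/-! ### Iterated reduction and permutability -/

section Iteration

variable {m n k : ℕ} {M : Type*} [TopologicalSpace M] [ChartedSpace (EuclideanSpace ℝ (Fin m)) M]
  {e : Fin k → Mink n} {ξ : M → Mink n} {t : Fin k → M → Mink n} {σ : Equiv.Perm (Fin k)}

theorem iter_succ {n k : ℕ} {M : Type*} (e : Fin k → Mink n) (ξ : M → Mink n)
    (t : Fin k → M → Mink n) (σ : Equiv.Perm (Fin k)) (l : Fin k) :
    iter e ξ t σ l.succ = reduceStep e (σ l) (iter e ξ t σ l.castSucc) :=
  rfl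

theorem RegularOrder.lor_ne_zero {n k : ℕ} {M : Type*} {e : Fin k → Mink n} {ξ : M → Mink n}
    {t : Fin k → M → Mink n} {σ : Equiv.Perm (Fin k)} (hσ : RegularOrder e ξ t σ) (l : Fin k)
    (u : M) : lor (e (σ l)) ((iter e ξ t σ l.castSucc).1 u) ≠ 0 := by
  rw [lor_comm]
  exact hσ l u

theorem AdaptedFrame.iter (h : AdaptedFrame m ξ t) (he : ∀ i, lor (e i) (e i) = 1)
    (hσ : RegularOrder e ξ t σ) (l : Fin (k + 1)) :
    AdaptedFrame m (Ribaucour.iter e ξ t σ l).1 (Ribaucour.iter e ξ t σ l).2 := by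
  induction l using Fin.induction with
  | zero => exact h
  | succ l ih => exact ih.transport (he _) (hσ.lor_ne_zero l) (σ l)

/-- After `l` reductions, the lift and the normal fields stand to the hyperspheres used so far as
they do in the common intersection of these hyperspheres. -/
theorem AdaptedFrame.iter_sphere (h : AdaptedFrame m ξ t)
    (he : ∀ i j, lor (e i) (e j) = if i = j then 1 else 0) (hσ : RegularOrder e ξ t σ) (u : M)
    (l : Fin (k + 1)) (i : Fin k) (hi : i.castSucc < l) :
    lor ((Ribaucour.iter e ξ t σ l).1 u) (e (σ i)) = 0 ∧
      ∀ p, lor ((Ribaucour.iter e ξ t σ l).2 p u) (e (σ i)) = if p = σ i then 1 else 0 := by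
  induction l using Fin.induction with
  | zero => exact absurd hi (Fin.not_lt_zero _)
  | succ l ih =>
    have hl := h.iter (fun i => by simp [he]) hσ l.castSucc
    have hne := hσ.lor_ne_zero l u
    rw [iter_succ]
    rcases (Fin.castSucc_lt_succ_iff.mp hi).eq_or_lt with rfl | hlt
    · exact ⟨lor_reduceLift_sphere (by simp [he]) hne,
        fun p => hl.lor_transportNormal_sphere hne p (σ i)⟩
    · obtain ⟨h1, h2⟩ := ih (Fin.castSucc_lt_castSucc_iff.mpr hlt)
      constructor
      -- Against an earlier hypersphere, the Kronecker deltas coming from the normal field and from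
      -- e (σ l) cancel.
      · simp [reduceStep, reduceLift, lor_sub_left, lor_add_left, lor_smul_left, h1, h2, he]
      · intro p
        simp [reduceStep, transportNormal, lor_sub_left, lor_smul_left, h1, h2]

/-- `η` is a combination of `ξ` and the `tᵢ - eᵢ` with smooth coefficients. -/
def IsSmoothCombo (m : ℕ) {n k : ℕ} {M : Type*} [TopologicalSpace M]
    [ChartedSpace (EuclideanSpace ℝ (Fin m)) M] (e : Fin k → Mink n) (ξ : M → Mink n)
    (t : Fin k → M → Mink n) (η : M → Mink n) : Prop :=
  ∃ (a₀ : M → ℝ) (a : Fin k → M → ℝ), ContMDiff (𝓡 m) 𝓘(ℝ, ℝ) ∞ a₀ ∧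
    (∀ i, ContMDiff (𝓡 m) 𝓘(ℝ, ℝ) ∞ (a i)) ∧
    ∀ u, η u = combo e ξ t (a₀ u) (fun i => a i u) u

namespace IsSmoothCombo

variable {η ζ : M → Mink n}

theorem add (hη : IsSmoothCombo m e ξ t η) (hζ : IsSmoothCombo m e ξ t ζ) :
    IsSmoothCombo m e ξ t fun u => η u + ζ u := by
  obtain ⟨a₀, a, h0, h1, h2⟩ := hη
  obtain ⟨b₀, b, h0', h1', h2'⟩ := hζ
  refine ⟨fun u => a₀ u + b₀ u, fun i u => a i u + b i u, h0.add h0',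
    fun i => (h1 i).add (h1' i), fun u => ?_⟩
  simp only [h2, h2', combo, add_smul, Finset.sum_add_distrib]
  abel

theorem smul {c : M → ℝ} (hc : ContMDiff (𝓡 m) 𝓘(ℝ, ℝ) ∞ c) (hη : IsSmoothCombo m e ξ t η) :
    IsSmoothCombo m e ξ t fun u => c u • η u := by
  obtain ⟨a₀, a, h0, h1, h2⟩ := hη
  refine ⟨fun u => c u * a₀ u, fun i u => c u * a i u, hc.mul h0, fun i => hc.mul (h1 i),
    fun u => ?_⟩
  simp only [h2, combo, smul_add, Finset.smul_sum, mul_smul]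

theorem lift : IsSmoothCombo m e ξ t ξ :=
  ⟨fun _ => 1, fun _ _ => 0, contMDiff_const, fun _ => contMDiff_const, fun u => by simp [combo]⟩

theorem zero : IsSmoothCombo m e ξ t fun _ => 0 :=
  ⟨fun _ => 0, fun _ _ => 0, contMDiff_const, fun _ => contMDiff_const, fun u => by simp [combo]⟩

theorem normal_sub (j : Fin k) : IsSmoothCombo m e ξ t fun u => t j u - e j :=
  ⟨fun _ => 0, fun i _ => if i = j then 1 else 0, contMDiff_const, fun _ => contMDiff_const,
    fun u => by simp [combo]⟩

end IsSmoothCombo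

/-- With j = σ l, the next lift is (tⱼˡ - tⱼ) + (tⱼ - eⱼ) + c ξˡ. The induction therefore follows
the differences tᵢˡ - tᵢ, each of which changes by a smooth multiple of ξˡ. -/
theorem AdaptedFrame.isSmoothCombo_iter (h : AdaptedFrame m ξ t)
    (he : ∀ i, lor (e i) (e i) = 1) (hσ : RegularOrder e ξ t σ) (l : Fin (k + 1)) :
    IsSmoothCombo m e ξ t (Ribaucour.iter e ξ t σ l).1 ∧
      ∀ i, IsSmoothCombo m e ξ t fun u => (Ribaucour.iter e ξ t σ l).2 i u - t i u := by
  induction l using Fin.induction with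
  | zero =>
    refine ⟨.lift, fun i => ?_⟩
    convert IsSmoothCombo.zero (m := m) (e := e) (ξ := ξ) (t := t) with u
    exact sub_self _
  | succ l ih =>
    have hl := h.iter he hσ l.castSucc
    have hl' := h.iter he hσ l.succ
    have hne := hσ.lor_ne_zero l
    obtain ⟨h1, h2⟩ := ih
    rw [iter_succ] at hl' ⊢
    generalize Ribaucour.iter e ξ t σ l.castSucc = d at *
    constructor
    · have hc : ContMDiff (𝓡 m) 𝓘(ℝ, ℝ) ∞ fun u =>
          (1 - lor (e (σ l)) (d.2 (σ l) u)) / lor (e (σ l)) (d.1 u) :=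
        (contMDiff_const.sub (smooth_lor contMDiff_const (hl.smooth_normal _))).div₀
          (smooth_lor contMDiff_const hl.smooth_lift) hne
      convert ((h2 (σ l)).add (.normal_sub (σ l))).add (h1.smul hc) with u
      simp only [reduceStep, reduceLift]
      abel
    · intro i
      have hc : ContMDiff (𝓡 m) 𝓘(ℝ, ℝ) ∞ fun u =>
          -(lor ((reduceStep e (σ l) d).1 u) (d.2 i u) /
            lor ((reduceStep e (σ l) d).1 u) (d.1 u)) := by
        refine ((smooth_lor hl'.smooth_lift (hl.smooth_normal i)).div₀
          (smooth_lor hl'.smooth_lift hl.smooth_lift) fun u => ?_).neg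
        change lor (reduceLift (e (σ l)) d.1 (d.2 (σ l)) u) (d.1 u) ≠ 0
        rw [hl.lor_reduceLift_lift]
        exact neg_ne_zero.mpr (hne u)
      convert (h2 i).add (h1.smul hc) with u
      simp only [reduceStep, transportNormal, neg_smul]
      abel

/-! ### The span of the successive lifts -/

section Span

variable {n k : ℕ} {M : Type*} (e : Fin k → Mink n) (ξ : M → Mink n) (t : Fin k → M → Mink n)
  (σ : Equiv.Perm (Fin k))

theorem iter_normal_sub_mem_span (u : M) (l : Fin (k + 1)) (i : Fin k) :
    (iter e ξ t σ l).2 i u - t i u ∈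
      Submodule.span ℝ (Set.range fun p => (iter e ξ t σ p).1 u) := by
  induction l using Fin.induction with
  | zero =>
    rw [show (iter e ξ t σ 0).2 i u - t i u = 0 from sub_self _]
    exact zero_mem _
  | succ l ih =>
    rw [iter_succ]
    simp only [reduceStep, transportNormal]
    rw [sub_right_comm]
    exact sub_mem ih (Submodule.smul_mem _ _ (Submodule.subset_span ⟨l.castSucc, rfl⟩))

/-- The reduction formula is solved for tⱼ - eⱼ = ξˡ⁺¹ - c ξˡ - (tⱼˡ - tⱼ) with j = σ l. This is
pointwise algebra and needs no regularity. -/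
theorem combo_mem_span (u : M) (a₀ : ℝ) (a : Fin k → ℝ) :
    combo e ξ t a₀ a u ∈ Submodule.span ℝ (Set.range fun p => (iter e ξ t σ p).1 u) := by
  have hmem (p : Fin (k + 1)) : (iter e ξ t σ p).1 u ∈
      Submodule.span ℝ (Set.range fun p => (iter e ξ t σ p).1 u) :=
    Submodule.subset_span ⟨p, rfl⟩
  refine add_mem (Submodule.smul_mem _ _ (hmem 0))
    (Submodule.sum_mem _ fun i _ => Submodule.smul_mem _ _ ?_)
  obtain ⟨l, rfl⟩ := σ.surjective i
  have h := sub_mem (sub_mem (hmem l.succ) (Submodule.smul_mem _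
    ((1 - lor (e (σ l)) ((iter e ξ t σ l.castSucc).2 (σ l) u)) /
      lor (e (σ l)) ((iter e ξ t σ l.castSucc).1 u)) (hmem l.castSucc)))
    (iter_normal_sub_mem_span e ξ t σ u l.castSucc (σ l))
  convert h using 1
  rw [iter_succ]
  simp only [reduceStep, reduceLift]
  abel

end Span

/-- The solutions of the linear system that defines the Ribaucour coordinates are the multiples of
the end result of the iteration. -/
theorem AdaptedFrame.combo_mem_span_last (h : AdaptedFrame m ξ t)
    (he : ∀ i j, lor (e i) (e j) = if i = j then 1 else 0) (hσ : RegularOrder e ξ t σ) {u : M}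
    {a₀ : ℝ} {a : Fin k → ℝ} (ha : ∀ i, lor (combo e ξ t a₀ a u) (e i) = 0) :
    combo e ξ t a₀ a u ∈ Submodule.span ℝ {(Ribaucour.iter e ξ t σ (Fin.last k)).1 u} := by
  obtain ⟨b, hb⟩ := (Submodule.mem_span_range_iff_exists_fun ℝ).mp
    (combo_mem_span e ξ t σ u a₀ a)
  -- Forward substitution: in the product with e (σ i), terms p < i vanish by induction and terms p
  -- > i because ξᵖ already lies in that hypersphere. Regularity makes the remaining factor
  -- non-zero.
  have hb0 (i : Fin k) : b i.castSucc = 0 := by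
    induction i using WellFoundedLT.induction with
    | ind i ih =>
      have h1 := ha (σ i)
      rw [← hb, lor_sum_left, Finset.sum_eq_single i.castSucc] at h1
      · rw [lor_smul_left] at h1
        exact (mul_eq_zero.mp h1).resolve_right (hσ i u)
      · intro p _ hp
        rw [lor_smul_left]
        rcases hp.lt_or_gt with hlt | hgt
        · obtain ⟨q, rfl⟩ := Fin.exists_castSucc_eq.mpr (ne_of_lt (hlt.trans_le (Fin.le_last _)))
          rw [ih q (Fin.castSucc_lt_castSucc_iff.mp hlt), zero_mul]
        · rw [(h.iter_sphere he hσ u p i hgt).1, mul_zero]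
      · exact fun hi => absurd (Finset.mem_univ _) hi
  rw [← hb, Fin.sum_univ_castSucc]
  simp only [hb0, zero_smul, Finset.sum_const_zero, zero_add]
  exact Submodule.smul_mem _ _ (Submodule.mem_span_singleton_self _)

end Iteration

end Ribaucour

end

/-! ### Assembly of the theorem -/

theorem mainTheorem1 (m k : ℕ) {M : Type*} [TopologicalSpace M]
    [ChartedSpace (EuclideanSpace ℝ (Fin m)) M] [IsManifold (𝓡 m) ∞ M]
    (x : M → Ribaucour.ConfSphere (m + k)) (hx : Ribaucour.IsImmersion m x)
    (ξ : M → Ribaucour.Mink (m + k)) (hξ : Ribaucour.IsLift m ξ x)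
    (t : Fin k → M → Ribaucour.Mink (m + k))
    (ht : ∀ i, Ribaucour.IsParallelUnitNormal m ξ (t i))
    (htt : ∀ i j, i ≠ j → ∀ u, Ribaucour.lor (t i u) (t j u) = 0)
    (e : Fin k → Ribaucour.Mink (m + k))
    (he : ∀ i, Ribaucour.lor (e i) (e i) = 1)
    (hee : ∀ i j, i ≠ j → Ribaucour.lor (e i) (e j) = 0)
    (hreg : ∃ σ, Ribaucour.RegularOrder e ξ t σ) :
    ∃ x' : M → Ribaucour.ConfSphere (m + k),
      -- the non-zero solutions of the linear system exist, and all of them span `x'`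
      (∀ u, ∃ (a₀ : ℝ) (a : Fin k → ℝ), Ribaucour.combo e ξ t a₀ a u ≠ 0 ∧
        ∀ i, Ribaucour.lor (Ribaucour.combo e ξ t a₀ a u) (e i) = 0) ∧
      (∀ (u : M) (a₀ : ℝ) (a : Fin k → ℝ), Ribaucour.combo e ξ t a₀ a u ≠ 0 →
        (∀ i, Ribaucour.lor (Ribaucour.combo e ξ t a₀ a u) (e i) = 0) →
        (x' u).line = Submodule.span ℝ {Ribaucour.combo e ξ t a₀ a u}) ∧
      -- they can be chosen smoothly, so as to give a lift of `x'`
      (∃ (a₀ : M → ℝ) (a : Fin k → M → ℝ), ContMDiff (𝓡 m) 𝓘(ℝ, ℝ) ∞ a₀ ∧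
        (∀ i, ContMDiff (𝓡 m) 𝓘(ℝ, ℝ) ∞ (a i)) ∧
        Ribaucour.IsLift m (fun u => Ribaucour.combo e ξ t (a₀ u) (fun i => a i u) u) x') ∧
      -- `x'` takes values in the `m`-sphere that is the intersection of the hyperspheres
      (∀ u i, Ribaucour.OnHypersphere (x' u) (e i)) ∧
      -- in whichever order the hyperspheres are taken, the iterated Ribaucour transform is `x'`
      ∀ σ, Ribaucour.RegularOrder e ξ t σ →
        ∃ y : Fin (k + 1) → M → Ribaucour.ConfSphere (m + k),
          y 0 = x ∧ y (Fin.last k) = x' ∧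
          (∀ l, Ribaucour.IsLift m (Ribaucour.iter e ξ t σ l).1 (y l)) ∧
          (∀ l, Ribaucour.IsImmersion m (y l) → ∀ i,
            Ribaucour.IsParallelUnitNormal m (Ribaucour.iter e ξ t σ l).1
              ((Ribaucour.iter e ξ t σ l).2 i)) ∧
          ∀ l : Fin k,
            (∀ i ≤ l, ∀ u, Ribaucour.OnHypersphere (y l.succ u) (e (σ i))) ∧
            Ribaucour.RibaucourConditions m (y l.castSucc) (y l.succ) ∧
            (Ribaucour.IsImmersion m (y l.castSucc) → Ribaucour.IsImmersion m (y l.succ) →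
              Ribaucour.IsRibaucourPair m (y l.castSucc) (y l.succ)) := by
  have hA := Ribaucour.AdaptedFrame.of_parallel hξ ht htt
  have horth (i j : Fin k) : Ribaucour.lor (e i) (e j) = if i = j then 1 else 0 := by
    split_ifs with h
    · rw [← h, he]
    · exact hee i j h
  have hlast {σ : Equiv.Perm (Fin k)} (hσ : Ribaucour.RegularOrder e ξ t σ) (u : M) (i : Fin k) :
      Ribaucour.lor ((Ribaucour.iter e ξ t σ (Fin.last k)).1 u) (e i) = 0 := by
    obtain ⟨l, rfl⟩ := σ.surjective i
    exact (hA.iter_sphere horth hσ u (Fin.last k) l (Fin.castSucc_lt_last l)).1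
  have hcombo {σ : Equiv.Perm (Fin k)} (hσ : Ribaucour.RegularOrder e ξ t σ) :=
    (hA.isSmoothCombo_iter he hσ (Fin.last k)).1
  have hline {σ : Equiv.Perm (Fin k)} (hσ : Ribaucour.RegularOrder e ξ t σ) (u : M) (a₀ : ℝ)
      (a : Fin k → ℝ) (h0 : Ribaucour.combo e ξ t a₀ a u ≠ 0)
      (ha : ∀ i, Ribaucour.lor (Ribaucour.combo e ξ t a₀ a u) (e i) = 0) :
      ((hA.iter he hσ (Fin.last k)).point u).line =
        Submodule.span ℝ {Ribaucour.combo e ξ t a₀ a u} := by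
    refine Ribaucour.ConfSphere.line_eq_span h0 ?_
    rw [Ribaucour.AdaptedFrame.line_point]
    exact hA.combo_mem_span_last horth hσ ha
  -- The map x' is defined through one regular order τ; `hline`, valid for every regular order,
  -- removes the dependence on this choice.
  obtain ⟨τ, hτ⟩ := hreg
  have hB := hA.iter he hτ (Fin.last k)
  refine ⟨hB.point, fun u => ?_, hline hτ, ?_, fun u i y hy => ?_, fun σ hσ => ?_⟩
  · obtain ⟨a₀, a, -, -, h⟩ := hcombo hτ
    refine ⟨a₀ u, fun i => a i u, ?_, ?_⟩
    · rw [← h]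
      exact hB.ne_zero u
    · rw [← h]
      exact hlast hτ u
  · obtain ⟨a₀, a, h0, h1, h⟩ := hcombo hτ
    refine ⟨a₀, a, h0, h1, ?_⟩
    rw [← funext h]
    exact hB.isLift
  · rw [hB.line_point] at hy
    obtain ⟨c, rfl⟩ := Submodule.mem_span_singleton.mp hy
    rw [Ribaucour.lor_smul_left, hlast hτ, mul_zero]
  · have hC (l : Fin (k + 1)) := hA.iter he hσ l
    have hrib (l : Fin k) :
        Ribaucour.RibaucourConditions m (hC l.castSucc).point (hC l.succ).point :=
      (hC l.castSucc).ribaucourConditions (he (σ l)) (hσ.lor_ne_zero l) (σ l)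
    refine ⟨fun l => (hC l).point, funext fun u => ?_, funext fun u => ?_,
      fun l => (hC l).isLift, fun l hl => (hC l).isParallelUnitNormal hl,
      fun l => ⟨fun i hi u y hy => ?_, hrib l, fun h1 h2 => ⟨h1, h2, hrib l⟩⟩⟩
    · refine Ribaucour.ConfSphere.ext_line ?_
      rw [hξ.line_eq, (hC 0).line_point]
      rfl
    · obtain ⟨a₀, a, -, -, h⟩ := hcombo hτ
      refine Ribaucour.ConfSphere.ext_line ?_
      rw [hB.line_point, h]
      -- The final lift for τ is itself a non-zero solution of the system, so it spans the final
      -- point for σ.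
      refine hline hσ u _ _ ?_ ?_
      · rw [← h]
        exact hB.ne_zero u
      · rw [← h]
        exact hlast hτ u
    · rw [(hC l.succ).line_point] at hy
      obtain ⟨c, rfl⟩ := Submodule.mem_span_singleton.mp hy
      rw [Ribaucour.lor_smul_left, (hA.iter_sphere horth hσ u l.succ i
        (Fin.castSucc_lt_succ_iff.mpr hi)).1, mul_zero]
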